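/- Let $\gamma,\beta\in\mathbb{R}$ with $|\gamma|<\pi/2$ and $\beta<1$, let $\mathbb{D}=\{z\in\mathbb{C}:|z|<1\}$, and let $\lambda\in\mathbb{D}$ and $z_0\in\mathbb{D}\setminus\{0\}$. Let $\mathcal{P}(\lambda)$ be the class of all analytic functions $P:\mathbb{D}\to\mathbb{C}$ with $P(0)=1$, $\operatorname{Re}\left(e^{i\gamma}P(z)\right)>\beta\cos\gamma$ for all $z\in\mathbb{D}$, and $P'(0)=2(1-\beta)\lambda e^{-i\gamma}\cos\gamma$. Put $$V_{\mathcal{P}}(z_0,\lambda)=\left\{\int_0^{z_0}P(\zeta)\,d\zeta : P\in\mathcal{P}(\lambda)\right\},\qquad \delta(z,\lambda)=\frac{z+\lambda}{1+\overline{\lambda}z},$$ $$H_{a,\lambda}(z)=1+2(1-\beta)e^{-i\gamma}\cos\gamma\,\frac{\delta(az,\lambda)z}{1-\delta(az,\lambda)z}\qquad(|a|\le 1,\ z\in\mathbb{D}).$$ Then the boundary $\partial V_{\mathcal{P}}(z_0,\lambda)$ is the Jordan curve given by $$(-\pi,\pi]\ni\theta\mapsto\int_0^{z_0}H_{e^{i\theta},\lambda}(\zeta)\,d\zeta=\int_0^{z_0}\frac{1+\left[2(1-\beta)(\cos\gamma)e^{-i\gamma}-1\right]\delta(e^{i\theta}\zeta,\lambda)\zeta}{1-\delta(e^{i\theta}\zeta,\lambda)\zeta}\,d\zeta;$$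 that is, the same formula on $[-\pi,\pi]$ defines a continuous curve with equal values at $\pm\pi$, it is injective on $(-\pi,\pi]$, and its image is exactly $\partial V_{\mathcal{P}}(z_0,\lambda)$. Moreover, if $\int_0^{z_0}P(\zeta)\,d\zeta=\int_0^{z_0}H_{e^{i\theta},\lambda}(\zeta)\,d\zeta$ for some $P\in\mathcal{P}(\lambda)$ and $\theta\in(-\pi,\pi]$, then $P(z)=H_{e^{i\theta},\lambda}(z)$ for all $z\in\mathbb{D}$. -/

import Mathlib

noncomputable section

namespace VarRegion

/-- The integral `∫₀^z f(ζ) dζ`, taken along the straight segment from `0` to `z`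
(for `f` analytic in the unit disk and `z` in the disk, any other path gives the same value). -/
def integralFromZero (f : ℂ → ℂ) (z : ℂ) : ℂ :=
  ∫ t in (0 : ℝ)..1, f ((t : ℂ) * z) * z

/-- The class of functions `P`, analytic in the unit disk, with `P(0) = 1` and
`Re (e^{iγ} P(z)) > β cos γ` in the disk. Values of `P` outside the disk play no role. -/
def classP (γ β : ℝ) : Set (ℂ → ℂ) :=
  {P | DifferentiableOn ℂ P (Metric.ball 0 1) ∧ P 0 = 1 ∧
    ∀ z ∈ Metric.ball (0 : ℂ) 1,
      β * Real.cos γ < (Complex.exp (Complex.I * γ) * P z).re}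

/-- The constant `2 (1 - β) e^{-iγ} cos γ`. -/
def kappa (γ β : ℝ) : ℂ :=
  2 * (1 - (β : ℂ)) * Complex.exp (-Complex.I * γ) * (Real.cos γ : ℂ)

/-- The members `P` of `classP γ β` with `P'(0) = 2 (1 - β) e^{-iγ} lam cos γ`. -/
def classPAt (γ β : ℝ) (lam : ℂ) : Set (ℂ → ℂ) :=
  {P | P ∈ classP γ β ∧ deriv P 0 = kappa γ β * lam}

/-- The region of variability of `∫₀^{z₀} P(ζ) dζ` as `P` ranges over `classPAt γ β lam`. -/
def region (γ β : ℝ) (z₀ lam : ℂ) : Set ℂ :=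
  {w | ∃ P ∈ classPAt γ β lam, integralFromZero P z₀ = w}

/-- `δ(z, lam) = (z + lam) / (1 + conj(lam) z)`. -/
def delta (z lam : ℂ) : ℂ :=
  (z + lam) / (1 + starRingEnd ℂ lam * z)

/-- `H_{a,lam}(z) = 1 + 2 (1 - β) e^{-iγ} cos γ · δ(az, lam) z / (1 - δ(az, lam) z)`. -/
def extremal (γ β : ℝ) (a lam z : ℂ) : ℂ :=
  1 + kappa γ β * (delta (a * z) lam * z / (1 - delta (a * z) lam * z))

/-- `J` is a Jordan curve (simple closed curve), and `Γ`, on `(-π, π]`, is a parametrization of it: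
`Γ` is a closed continuous curve on `[-π, π]`, simple, with trace `J`. -/
def IsJordanCurveGivenBy (J : Set ℂ) (Γ : ℝ → ℂ) : Prop :=
  ContinuousOn Γ (Set.Icc (-Real.pi) Real.pi) ∧
  Γ (-Real.pi) = Γ Real.pi ∧
  Set.InjOn Γ (Set.Ioc (-Real.pi) Real.pi) ∧
  Γ '' Set.Ioc (-Real.pi) Real.pi = J

end VarRegion

end

/-!
Write `κ = kappa γ β`. A function `P` in `classPAt γ β lam` is of the form
`P z = 1 + κ δ z / (1 - δ z)` with `δ = delta (ψ z * z) lam` for a holomorphic map `ψ` of the unit disk into the closed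
unit disk (two applications of the Schwarz lemma, `exists_eqOn_extremal_of_mem_classPAt`), and the
extremal functions are those with `ψ` constant and unimodular.

Fix `a` with `‖a‖ = 1` and put `D z = 1 + (conj lam * a - lam) z - a z ^ 2`. An explicit
computation gives `H_a z - P z = κ a (1 - |lam|²) (z / D z) ^ 2 h z`, where `h` is holomorphic
and, unless `P = H_a`, `0 < Re h` on the whole disk. The primitive `G` of `(z / D z) ^ 2` that
vanishes at `0` satisfies `0 < Re (1 + z G'' / G')`, and this is enough to transfer the sign of
`Re h` to the quotient of the integrals: `0 < Re ((∫ (z / D) ^ 2 h) / G)` at `z₀`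
(`re_div_pos_of_re_pos`). The argument looks at a minimizer `z` of `Re p` on a closed disk, for
`p = G / (z G')` and then for `p` the quotient of the integrals: there `z p'(z)` is real and
nonpositive, and the differential equation satisfied by `p` forces `0 < Re (p z)`. No univalence
and no special path of integration is needed.

Hence the integral of `H_a` strictly maximizes a nonzero real-linear functional over the region,
and no other function of the class has that integral (`exists_support_functional`). This gives the
uniqueness assertion, the injectivity of the curve, and that the curve lies in the frontier. The
region is convex, and has interior points since three exposed points are not collinear. A simple
closed curve in the frontier of such a set is the whole frontier, by radial projection from an
interior point and the intermediate value theorem (`image_eq_frontier_of_convex`).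
-/

namespace VarRegion

open Metric Set Filter Topology ComplexConjugate

/-! ### Minimizers of real parts and convex functions -/

/-- The point `z` is a minimizer of `Re p` on the closed disk of radius `‖z₀‖`. Along the circle
through `z` the derivative of `Re p` vanishes, and along the radius towards `0` it is nonnegative,
so `z p'(z)` is a nonpositive real number. -/
theorem exists_re_le_and_mul_deriv_nonpos {p : ℂ → ℂ} (hp : DifferentiableOn ℂ p (ball 0 1))
    {z₀ : ℂ} (hz₀ : ‖z₀‖ < 1) :
    ∃ z, ‖z‖ < 1 ∧ (p z).re ≤ (p z₀).re ∧
      (z * deriv p z).im = 0 ∧ (z * deriv p z).re ≤ 0 := by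
  have hsub : closedBall (0 : ℂ) ‖z₀‖ ⊆ ball 0 1 := closedBall_subset_ball hz₀
  obtain ⟨z, hz, hmin⟩ := (isCompact_closedBall (0 : ℂ) ‖z₀‖).exists_isMinOn
    ⟨z₀, by simp⟩ (Complex.continuous_re.comp_continuousOn (hp.continuousOn.mono hsub))
  have hz1 : z ∈ ball (0 : ℂ) 1 := hsub hz
  have hle : ‖z‖ ≤ ‖z₀‖ := by simpa using hz
  have hd : ∀ w : ℂ, HasDerivAt (fun s : ℝ => (p (Complex.exp (s * w) * z)).re)
      (w * (z * deriv p z)).re 0 := by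
    -- `w = I` moves along the circle through `z`, and `w = -1` along the radius towards `0`.
    intro w
    have h1 : HasDerivAt p (deriv p z) (Complex.exp ((0 : ℂ) * w) * z) := by
      simpa using (hp.differentiableAt (isOpen_ball.mem_nhds hz1)).hasDerivAt
    have h2 : HasDerivAt (fun s : ℂ => Complex.exp (s * w) * z) (w * z) 0 := by
      simpa using (((hasDerivAt_id (0 : ℂ)).mul_const w).cexp).mul_const z
    have h3 := (h1.comp (0 : ℂ) h2)
    have h4 := HasDerivAt.real_of_complex (z := (0 : ℝ)) (by simpa using h3)
    exact h4.congr_deriv (congrArg Complex.re (by ring))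
  refine ⟨z, by simpa using hz1, hmin (by simp : z₀ ∈ closedBall (0 : ℂ) ‖z₀‖), ?_, ?_⟩
  · have hloc : IsLocalMin (fun s : ℝ => (p (Complex.exp (s * Complex.I) * z)).re) 0 := by
      refine Eventually.of_forall fun s => ?_
      have : Complex.exp (s * Complex.I) * z ∈ closedBall (0 : ℂ) ‖z₀‖ := by
        simpa [Complex.norm_exp_ofReal_mul_I] using hle
      simpa using hmin this
    have := hloc.hasDerivAt_eq_zero (hd Complex.I)
    rw [Complex.I_mul_re] at this
    linarith
  · have ht := (hasDerivWithinAt_iff_tendsto_slope' (by simp : (0 : ℝ) ∉ Ioi 0)).1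
      ((hd (-1)).hasDerivWithinAt (s := Ioi 0))
    have : 0 ≤ (-1 * (z * deriv p z)).re := by
      refine ge_of_tendsto ht ?_
      filter_upwards [self_mem_nhdsWithin] with s hs
      have hs : 0 < s := hs
      have hmem : Complex.exp (s * (-1)) * z ∈ closedBall (0 : ℂ) ‖z₀‖ := by
        have h5 : ‖Complex.exp ((s : ℂ) * (-1))‖ ≤ 1 := by
          rw [Complex.norm_exp]; simp [hs.le]
        rw [mem_closedBall_zero_iff, norm_mul]
        exact (mul_le_of_le_one_left (norm_nonneg _) h5).trans hle
      have h6 : (p z).re ≤ (p (Complex.exp (s * (-1)) * z)).re := hmin hmem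
      rw [slope_def_field]
      refine div_nonneg ?_ (by simpa using hs.le)
      simpa using h6
    simpa using this

/-- Equivalently, `(z ^ (n + 1) * M z)' = z ^ n * m z`: the primitive of `z ^ n * m z` vanishing
at `0` is divisible by `z ^ (n + 1)`. -/
theorem exists_add_mul_deriv_eq (n : ℕ) {m : ℂ → ℂ} (hm : DifferentiableOn ℂ m (ball 0 1)) :
    ∃ M : ℂ → ℂ, DifferentiableOn ℂ M (ball 0 1) ∧
      ∀ z ∈ ball (0 : ℂ) 1, (n + 1) * M z + z * deriv M z = m z := by
  have hnhds : ball (0 : ℂ) 1 ∈ 𝓝 0 := ball_mem_nhds _ one_pos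
  induction n generalizing m with
  | zero =>
    obtain ⟨G, hG0, hG⟩ := hm.isExactOn_ball.with_val_at 0 0
    have hGd : DifferentiableOn ℂ G (ball 0 1) :=
      fun z hz => (hG z hz).differentiableAt.differentiableWithinAt
    have hM : DifferentiableOn ℂ (dslope G 0) (ball 0 1) :=
      (Complex.differentiableOn_dslope hnhds).2 hGd
    refine ⟨dslope G 0, hM, fun z hz => ?_⟩
    have h1 : HasDerivAt (dslope G 0) (deriv (dslope G 0) z) z :=
      (hM.differentiableAt (isOpen_ball.mem_nhds hz)).hasDerivAt
    have h2 : HasDerivAt (id * dslope G 0) _ z := (hasDerivAt_id z).mul h1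
    have h3 : id * dslope G 0 = G := by
      funext y
      have := sub_smul_dslope G 0 y
      simpa [hG0] using this
    rw [h3] at h2
    have h4 := h2.unique (hG z hz)
    simpa using h4
  | succ n ih =>
    obtain ⟨N, hN, hNe⟩ := ih (m := fun z => z * m z) (differentiableOn_id.mul hm)
    have hN0 : N 0 = 0 := by
      have := hNe 0 (by simp)
      have h : (n : ℂ) + 1 ≠ 0 := Nat.cast_add_one_ne_zero n
      simpa [h] using this
    have hM : DifferentiableOn ℂ (dslope N 0) (ball 0 1) :=
      (Complex.differentiableOn_dslope hnhds).2 hN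
    have h3 : id * dslope N 0 = N := by
      funext y
      have := sub_smul_dslope N 0 y
      simpa [hN0] using this
    refine ⟨dslope N 0, hM, ?_⟩
    set M := dslope N 0
    have hpunct : ∀ z ∈ ball (0 : ℂ) 1, z ≠ 0 →
        ((n + 1 : ℕ) + 1 : ℂ) * M z + z * deriv M z = m z := by
      intro z hz hz0
      have h1 : HasDerivAt M (deriv M z) z :=
        (hM.differentiableAt (isOpen_ball.mem_nhds hz)).hasDerivAt
      have h2 : HasDerivAt (id * M) _ z := (hasDerivAt_id z).mul h1
      rw [h3] at h2
      have h4 : deriv N z = M z + z * deriv M z := by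
        simpa using h2.deriv
      have h5 := hNe z hz
      have h6 : N z = z * M z := (congrFun h3 z).symm
      rw [h4, h6] at h5
      apply mul_left_cancel₀ hz0
      rw [← h5]
      push_cast
      ring
    intro z hz
    rcases eq_or_ne z 0 with rfl | hz0
    · have hc : ContinuousAt (fun z => ((n + 1 : ℕ) + 1 : ℂ) * M z + z * deriv M z) 0 :=
        ((continuousAt_const.mul (hM.differentiableAt hnhds).continuousAt).add
          (continuousAt_id.mul ((hM.deriv isOpen_ball).differentiableAt hnhds).continuousAt))
      have hc' : ContinuousAt m 0 := (hm.differentiableAt hnhds).continuousAt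
      refine tendsto_nhds_unique_of_eventuallyEq (l := 𝓝[≠] (0 : ℂ))
        (hc.tendsto.mono_left nhdsWithin_le_nhds) (hc'.tendsto.mono_left nhdsWithin_le_nhds) ?_
      filter_upwards [self_mem_nhdsWithin, nhdsWithin_le_nhds hnhds] with y hy hy'
      exact hpunct y hy' hy
    · exact hpunct z hz hz0

/-- Convexity implies starlikeness, for `G z = z ^ (n + 1) * M z` with `G' z = z ^ n * m z`: the
hypothesis `hstar` reads `0 < Re (1 + z G'' / G')`, and the conclusion `0 < Re (G / (z G'))`. -/
theorem re_div_pos_of_add_mul_deriv_eq (n : ℕ) {m M : ℂ → ℂ}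
    (hm : DifferentiableOn ℂ m (ball 0 1)) (hM : DifferentiableOn ℂ M (ball 0 1))
    (hm0 : ∀ z ∈ ball (0 : ℂ) 1, m z ≠ 0)
    (hstar : ∀ z ∈ ball (0 : ℂ) 1, 0 < (n + 1 + z * deriv m z / m z).re)
    (hMm : ∀ z ∈ ball (0 : ℂ) 1, (n + 1) * M z + z * deriv M z = m z)
    {z : ℂ} (hz : z ∈ ball (0 : ℂ) 1) : 0 < (M z / m z).re := by
  obtain ⟨w, hw, hle, him, hre⟩ := exists_re_le_and_mul_deriv_nonpos (hM.div hm hm0)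
    (mem_ball_zero_iff.1 hz)
  have hwb : w ∈ ball (0 : ℂ) 1 := by simpa using hw
  refine lt_of_lt_of_le ?_ hle
  have hmw := hm0 w hwb
  have hd : deriv (M / m) w = (deriv M w * m w - M w * deriv m w) / m w ^ 2 :=
    ((hM.differentiableAt (isOpen_ball.mem_nhds hwb)).hasDerivAt.div
      (hm.differentiableAt (isOpen_ball.mem_nhds hwb)).hasDerivAt hmw).deriv
  have hQ := hstar w hwb
  set Q : ℂ := n + 1 + w * deriv m w / m w with hQdef
  -- At the minimizer `w`, the right-hand side is a real number which is at least `1`.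
  have key : (M / m) w * Q = 1 - w * deriv (M / m) w := by
    rw [hd, Pi.div_apply, hQdef]
    field_simp
    linear_combination m w * hMm w hwb
  have hs : w * deriv (M / m) w = ((w * deriv (M / m) w).re : ℂ) := by
    apply Complex.ext <;> simp [him]
  have hQ0 : Q ≠ 0 := fun h => by simp [h] at hQ
  have hB : (M / m) w = ((1 - (w * deriv (M / m) w).re : ℝ) : ℂ) * Q⁻¹ := by
    rw [eq_mul_inv_iff_mul_eq₀ hQ0, key, hs]
    push_cast
    simp
  rw [hB, Complex.re_ofReal_mul, Complex.inv_re]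
  exact mul_pos (by linarith) (div_pos hQ (Complex.normSq_pos.2 hQ0))

/-- With `G z = z ^ (n + 1) * M z` and `F z = z ^ (n + 1) * N z`, this says that
`0 < Re (F' / G')` implies `0 < Re (F / G)` when `G` is convex in the sense of `hstar`. -/
theorem re_div_pos_of_re_pos (n : ℕ) {m h M N : ℂ → ℂ}
    (hm : DifferentiableOn ℂ m (ball 0 1))
    (hM : DifferentiableOn ℂ M (ball 0 1)) (hN : DifferentiableOn ℂ N (ball 0 1))
    (hm0 : ∀ z ∈ ball (0 : ℂ) 1, m z ≠ 0)
    (hstar : ∀ z ∈ ball (0 : ℂ) 1, 0 < (n + 1 + z * deriv m z / m z).re)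
    (hh : ∀ z ∈ ball (0 : ℂ) 1, 0 < (h z).re)
    (hMm : ∀ z ∈ ball (0 : ℂ) 1, (n + 1) * M z + z * deriv M z = m z)
    (hNm : ∀ z ∈ ball (0 : ℂ) 1, (n + 1) * N z + z * deriv N z = m z * h z)
    {z : ℂ} (hz : z ∈ ball (0 : ℂ) 1) : 0 < (N z / M z).re := by
  have hB : ∀ z ∈ ball (0 : ℂ) 1, 0 < (M z / m z).re := fun z hz =>
    re_div_pos_of_add_mul_deriv_eq n hm hM hm0 hstar hMm hz
  have hM0 : ∀ z ∈ ball (0 : ℂ) 1, M z ≠ 0 := fun z hz h => by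
    simpa [h] using hB z hz
  obtain ⟨w, hw, hle, him, hre⟩ := exists_re_le_and_mul_deriv_nonpos (hN.div hM hM0)
    (mem_ball_zero_iff.1 hz)
  have hwb : w ∈ ball (0 : ℂ) 1 := by simpa using hw
  refine lt_of_lt_of_le ?_ hle
  have hmw := hm0 w hwb
  have hMw := hM0 w hwb
  have hd : deriv (N / M) w = (deriv N w * M w - N w * deriv M w) / M w ^ 2 :=
    ((hN.differentiableAt (isOpen_ball.mem_nhds hwb)).hasDerivAt.div
      (hM.differentiableAt (isOpen_ball.mem_nhds hwb)).hasDerivAt hMw).deriv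
  -- At the minimizer `w`, a nonpositive real multiple of `M w / m w` is subtracted from `h w`.
  have key : (N / M) w = h w - (w * deriv (N / M) w) * (M w / m w) := by
    rw [hd, Pi.div_apply]
    field_simp
    linear_combination M w * hNm w hwb - N w * hMm w hwb
  have hs : w * deriv (N / M) w = ((w * deriv (N / M) w).re : ℂ) := by
    apply Complex.ext <;> simp [him]
  rw [key, hs, Complex.sub_re, Complex.re_ofReal_mul]
  nlinarith [hh w hwb, hB w hwb]


/-! ### Simple closed curves in the frontier of a convex set -/

/-- There is no simple closed curve in the real line. -/
theorem not_injOn_of_continuousOn_of_eq {a b : ℝ} (hab : a < b) {h : ℝ → ℝ}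
    (hc : ContinuousOn h (Icc a b)) (heq : h a = h b) : ¬ InjOn h (Ioc a b) := by
  intro hinj
  -- A value between `h c` and `h b = h a` is taken on both sides of `c`.
  obtain ⟨c, hac, hcb⟩ := exists_between hab
  have hne : h c ≠ h b := fun e => hcb.ne (hinj ⟨hac, hcb.le⟩ ⟨hab, le_rfl⟩ e)
  have h1 : uIcc (h a) (h c) ⊆ h '' uIcc a c := intermediate_value_uIcc
    (hc.mono (by rw [uIcc_of_le hac.le]; exact Icc_subset_Icc_right hcb.le))
  have h2 : uIcc (h c) (h b) ⊆ h '' uIcc c b := intermediate_value_uIcc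
    (hc.mono (by rw [uIcc_of_le hcb.le]; exact Icc_subset_Icc_left hac.le))
  have hv : (h c + h b) / 2 ∈ uIcc (h c) (h b) := by
    rw [mem_uIcc]
    rcases le_total (h c) (h b) with h | h
    · left; constructor <;> linarith
    · right; constructor <;> linarith
  obtain ⟨y, hy, hyv⟩ := h2 hv
  obtain ⟨x, hx, hxv⟩ := h1 (by rw [uIcc_comm, heq]; exact hv)
  rw [uIcc_of_le hac.le] at hx
  rw [uIcc_of_le hcb.le] at hy
  have hxa : x ≠ a := by
    rintro rfl
    apply hne
    rw [heq] at hxv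
    linarith
  have hyc : y ≠ c := by
    rintro rfl
    apply hne
    linarith
  have hlt : a < x := lt_of_le_of_ne hx.1 hxa.symm
  have := hinj ⟨hlt, hx.2.trans hcb.le⟩ ⟨hac.trans_le hy.1, hy.2⟩ (hxv.trans hyv.symm)
  exact hyc (le_antisymm (this ▸ hx.2) hy.1)

/-- A ray issuing from an interior point of a convex set meets the frontier at most once. -/
theorem eq_of_mem_frontier_of_smul {V : Set ℂ} (hV : Convex ℝ V) {w₀ w w' : ℂ}
    (h₀ : w₀ ∈ interior V) (hw : w ∈ frontier V) (hw' : w' ∈ frontier V) {r : ℝ} (hr : 0 < r)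
    (h : w' - w₀ = r * (w - w₀)) : w = w' := by
  have aux : ∀ {w w' : ℂ}, w ∈ frontier V → w' ∈ frontier V → ∀ {r : ℝ}, 0 < r →
      w' - w₀ = r * (w - w₀) → 1 ≤ r := by
    intro w w' hw hw' r hr h
    by_contra! hlt
    refine hw'.2 (hV.openSegment_interior_closure_subset_interior h₀ hw.1
      ⟨1 - r, r, by linarith, hr, by ring, ?_⟩)
    simp only [Complex.real_smul]
    push_cast
    linear_combination -h
  have h1 := aux hw hw' hr h
  have hr0 : (r : ℂ) ≠ 0 := by exact_mod_cast hr.ne'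
  have h2 := aux hw' hw (inv_pos.2 hr) (by rw [h]; push_cast; field_simp)
  have hr1 : r = 1 := le_antisymm ((one_le_inv₀ hr).1 h2) h1
  rw [hr1, Complex.ofReal_one, one_mul] at h
  linear_combination -h

/-- A simple closed curve lying in the frontier of a convex set with nonempty interior covers the
frontier. If it missed the frontier point `w`, its radial projection from an interior point would
be a simple closed curve in a circle without one point, hence would give one in the real line. -/
theorem image_eq_frontier_of_convex {V : Set ℂ} (hV : Convex ℝ V) (hne : (interior V).Nonempty)
    {a b : ℝ} (hab : a < b) {Γ : ℝ → ℂ} (hc : ContinuousOn Γ (Icc a b)) (heq : Γ a = Γ b)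
    (hinj : InjOn Γ (Ioc a b)) (hΓ : ∀ t ∈ Ioc a b, Γ t ∈ frontier V) :
    Γ '' Ioc a b = frontier V := by
  refine Subset.antisymm (image_subset_iff.2 hΓ) fun w hw => ?_
  obtain ⟨w₀, h₀⟩ := hne
  by_contra hcon
  have hΓ' : ∀ t ∈ Icc a b, Γ t ∈ frontier V := by
    intro t ht
    rcases eq_or_lt_of_le ht.1 with rfl | h
    · exact heq ▸ hΓ b ⟨hab, le_rfl⟩
    · exact hΓ t ⟨h, ht.2⟩
  have hne0 : ∀ {v}, v ∈ frontier V → v - w₀ ≠ 0 := fun {v} hv h =>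
    hv.2 (sub_eq_zero.1 h ▸ h₀)
  have hmiss : ∀ t ∈ Icc a b, Γ t ≠ w := by
    intro t ht h
    rcases eq_or_lt_of_le ht.1 with rfl | h'
    · exact hcon ⟨b, ⟨hab, le_rfl⟩, heq ▸ h⟩
    · exact hcon ⟨t, ⟨h', ht.2⟩, h⟩
  -- The sign puts the direction of `w` on the branch cut of `arg`, which `u` therefore avoids.
  set u : ℝ → ℂ := fun t => -((Γ t - w₀) / (w - w₀)) with hu
  have hd := hne0 hw
  have hslit : ∀ t ∈ Icc a b, u t ∈ Complex.slitPlane := by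
    intro t ht
    by_contra hns
    rw [Complex.mem_slitPlane_iff, not_or, not_lt, not_not] at hns
    have hreal : (Γ t - w₀) / (w - w₀) = ((-(u t).re : ℝ) : ℂ) := by
      apply Complex.ext
      · simp [hu]
      · have := hns.2
        simpa [hu] using this
    have hmul : Γ t - w₀ = ((-(u t).re : ℝ) : ℂ) * (w - w₀) := by
      rw [← hreal, div_mul_cancel₀ _ hd]
    have hpos : 0 < -(u t).re := by
      refine lt_of_le_of_ne (by linarith [hns.1]) fun h0 => ?_
      rw [← h0] at hmul
      exact hne0 (hΓ' t ht) (by simpa using hmul)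
    exact hmiss t ht (eq_of_mem_frontier_of_smul hV h₀ hw (hΓ' t ht) hpos hmul).symm
  refine not_injOn_of_continuousOn_of_eq hab (h := fun t => (u t).arg) ?_
    (by simp only [hu, heq]) ?_
  · refine Complex.continuousOn_arg.comp ?_ hslit
    exact ((hc.sub continuousOn_const).div_const _).neg
  · intro s hs t ht hst
    have hs' := Ioc_subset_Icc_self hs
    have ht' := Ioc_subset_Icc_self ht
    have hus : u s ≠ 0 := Complex.slitPlane_ne_zero (hslit s hs')
    have hut : u t ≠ 0 := Complex.slitPlane_ne_zero (hslit t ht')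
    have h1 := (Complex.arg_eq_arg_iff hus hut).1 hst
    refine hinj hs ht (eq_of_mem_frontier_of_smul hV h₀ (hΓ s hs) (hΓ t ht)
      (r := ‖u t‖ / ‖u s‖) (div_pos (norm_pos_iff.2 hut) (norm_pos_iff.2 hus)) ?_)
    have h2 : ∀ x, Γ x - w₀ = -(u x) * (w - w₀) := fun x => by
      simp only [hu]; field_simp
    rw [h2, h2 s, ← h1, Complex.ofReal_div, h1]
    linear_combination (w - w₀) * h1

theorem interior_nonempty_of_convex {V : Set ℂ} (hV : Convex ℝ V)
    {x y z : ℂ} (hx : x ∈ V) (hy : y ∈ V) (hz : z ∈ V)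
    (h : ¬ Collinear ℝ {x, y, z}) : (interior V).Nonempty := by
  have hai : AffineIndependent ℝ ![x, y, z] := affineIndependent_iff_not_collinear_set.2 h
  have htop := hai.affineSpan_eq_top_iff_card_eq_finrank_add_one.2 (by simp)
  rw [hV.interior_nonempty_iff_affineSpan_eq_top, eq_top_iff, ← htop]
  apply affineSpan_mono
  rintro _ ⟨i, rfl⟩
  fin_cases i <;> simpa

/-! ### The integral, the Möbius maps and the class of functions -/

theorem ofReal_mul_mem_ball {z : ℂ} (hz : ‖z‖ < 1) {t : ℝ} (ht : t ∈ uIcc (0 : ℝ) 1) :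
    (t : ℂ) * z ∈ ball (0 : ℂ) 1 := by
  rw [uIcc_of_le zero_le_one] at ht
  rw [mem_ball_zero_iff, norm_mul, Complex.norm_real, Real.norm_of_nonneg ht.1]
  exact (mul_le_of_le_one_left (norm_nonneg _) ht.2).trans_lt hz

theorem integralFromZero_congr {f g : ℂ → ℂ} (h : EqOn f g (ball 0 1)) {z : ℂ} (hz : ‖z‖ < 1) :
    integralFromZero f z = integralFromZero g z := by
  refine intervalIntegral.integral_congr fun t ht => ?_
  simp only [h (ofReal_mul_mem_ball hz ht)]

theorem intervalIntegrable_segment {f : ℂ → ℂ} (hf : ContinuousOn f (ball 0 1)) {z : ℂ}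
    (hz : ‖z‖ < 1) :
    IntervalIntegrable (fun t : ℝ => f (t * z) * z) MeasureTheory.volume 0 1 := by
  refine ContinuousOn.intervalIntegrable ?_
  have : ContinuousOn (fun t : ℝ => (t : ℂ) * z) (uIcc 0 1) := by fun_prop
  exact (hf.comp this fun t ht => ofReal_mul_mem_ball hz ht).mul continuousOn_const

theorem integralFromZero_linear_combination {f g : ℂ → ℂ} (hf : ContinuousOn f (ball 0 1))
    (hg : ContinuousOn g (ball 0 1)) (a b : ℂ) {z : ℂ} (hz : ‖z‖ < 1) :
    integralFromZero (fun ζ => a * f ζ + b * g ζ) z =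
      a * integralFromZero f z + b * integralFromZero g z := by
  unfold integralFromZero
  rw [← intervalIntegral.integral_const_mul, ← intervalIntegral.integral_const_mul,
    ← intervalIntegral.integral_add ((intervalIntegrable_segment hf hz).const_mul a)
      ((intervalIntegrable_segment hg hz).const_mul b)]
  congr 1
  funext t
  ring

theorem integralFromZero_pow_mul (n : ℕ) {m M : ℂ → ℂ}
    (hm : DifferentiableOn ℂ m (ball 0 1)) (hM : DifferentiableOn ℂ M (ball 0 1))
    (hMm : ∀ z ∈ ball (0 : ℂ) 1, (n + 1) * M z + z * deriv M z = m z)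
    {z₀ : ℂ} (hz₀ : ‖z₀‖ < 1) :
    integralFromZero (fun z => z ^ n * m z) z₀ = z₀ ^ (n + 1) * M z₀ := by
  have hmem := fun t (ht : t ∈ uIcc (0 : ℝ) 1) => ofReal_mul_mem_ball hz₀ ht
  unfold integralFromZero
  rw [intervalIntegral.integral_eq_sub_of_hasDerivAt
    (f := fun t : ℝ => ((t : ℂ) * z₀) ^ (n + 1) * M (t * z₀))]
  · simp
  · intro t ht
    have h1 := (hM.differentiableAt (isOpen_ball.mem_nhds (hmem t ht))).hasDerivAt
    have h2 : HasDerivAt (fun z : ℂ => z ^ (n + 1) * M z)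
        (((t : ℂ) * z₀) ^ n * m (t * z₀)) (t * z₀) := by
      refine ((hasDerivAt_pow (n + 1) ((t : ℂ) * z₀)).mul h1).congr_deriv ?_
      rw [← hMm _ (hmem t ht)]
      push_cast
      ring
    have h3 : HasDerivAt (fun t : ℝ => (t : ℂ) * z₀) z₀ t := by
      simpa using (Complex.ofRealCLM.hasDerivAt (x := t)).mul_const z₀
    exact HasDerivAt.comp t h2 h3
  · refine ContinuousOn.intervalIntegrable ?_
    have : ContinuousOn (fun t : ℝ => (t : ℂ) * z₀) (uIcc 0 1) := by fun_prop
    exact (((this.pow n).mul (hm.continuousOn.comp this hmem))).mul continuousOn_const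

theorem sq_norm_sub_sq_norm (z lam : ℂ) :
    ‖1 + conj lam * z‖ ^ 2 - ‖z + lam‖ ^ 2 = (1 - ‖z‖ ^ 2) * (1 - ‖lam‖ ^ 2) := by
  simp only [Complex.sq_norm, Complex.normSq_apply, Complex.add_re, Complex.add_im,
    Complex.mul_re, Complex.mul_im, Complex.conj_re, Complex.conj_im, Complex.one_re,
    Complex.one_im]
  ring

theorem one_add_conj_mul_ne_zero {z lam : ℂ} (hlam : ‖lam‖ < 1) (hz : ‖z‖ ≤ 1) :
    1 + conj lam * z ≠ 0 := by
  intro h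
  have h1 : ‖conj lam * z‖ = 1 := by
    rw [← neg_eq_of_add_eq_zero_right h]; simp
  rw [norm_mul, RCLike.norm_conj] at h1
  nlinarith [norm_nonneg lam, norm_nonneg z]

theorem norm_delta_le_one {z lam : ℂ} (hlam : ‖lam‖ < 1) (hz : ‖z‖ ≤ 1) :
    ‖delta z lam‖ ≤ 1 := by
  have h0 := norm_pos_iff.2 (one_add_conj_mul_ne_zero hlam hz)
  rw [delta, norm_div, div_le_one h0]
  refine (sq_le_sq₀ (norm_nonneg _) (norm_nonneg _)).1 ?_
  have h1 : 0 ≤ 1 - ‖z‖ ^ 2 := by nlinarith [norm_nonneg z]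
  have h2 : 0 ≤ 1 - ‖lam‖ ^ 2 := by nlinarith [norm_nonneg lam]
  linarith [sq_norm_sub_sq_norm z lam, mul_nonneg h1 h2]

/-- The Möbius maps `delta · (-lam)` and `delta · lam` are inverse to each other. -/
theorem delta_delta_neg {z lam : ℂ} (hlam : ‖lam‖ < 1) (hz : ‖z‖ ≤ 1) :
    delta (delta z (-lam)) lam = z := by
  have h1 : 1 + conj (-lam) * z ≠ 0 := one_add_conj_mul_ne_zero (by simpa) hz
  have h2 : 1 + conj lam * delta z (-lam) ≠ 0 :=
    one_add_conj_mul_ne_zero hlam (norm_delta_le_one (by simpa) hz)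
  rw [delta, div_eq_iff h2]
  have hx : delta z (-lam) * (1 + conj (-lam) * z) = z + -lam := div_mul_cancel₀ _ h1
  rw [map_neg] at hx
  linear_combination hx

theorem norm_mul_le_of_norm_le_one {a z : ℂ} (ha : ‖a‖ ≤ 1) : ‖a * z‖ ≤ ‖z‖ := by
  rw [norm_mul]; exact mul_le_of_le_one_left (norm_nonneg _) ha

theorem norm_delta_mul_lt_one {a z lam : ℂ} (hlam : ‖lam‖ < 1) (ha : ‖a‖ ≤ 1) (hz : ‖z‖ < 1) :
    ‖delta (a * z) lam * z‖ < 1 :=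
  (norm_mul_le_of_norm_le_one (norm_delta_le_one hlam
    ((norm_mul_le_of_norm_le_one ha).trans hz.le))).trans_lt hz

theorem one_sub_ne_zero_of_norm_lt_one {x : ℂ} (hx : ‖x‖ < 1) : 1 - x ≠ 0 := fun h => by
  rw [← sub_eq_zero.1 h] at hx; simp at hx

theorem cos_pos_of_abs_lt {γ : ℝ} (hγ : |γ| < Real.pi / 2) : 0 < Real.cos γ :=
  Real.cos_pos_of_mem_Ioo (abs_lt.1 hγ)

theorem exp_mul_kappa (γ β : ℝ) :
    Complex.exp (Complex.I * γ) * kappa γ β = ((2 * ((1 - β) * Real.cos γ) : ℝ) : ℂ) := by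
  have h : Complex.exp (Complex.I * γ) * Complex.exp (-Complex.I * γ) = 1 := by
    rw [← Complex.exp_add]; simp
  unfold kappa
  push_cast
  linear_combination (2 * (1 - (β : ℂ)) * Complex.cos γ) * h

theorem kappa_ne_zero {γ β : ℝ} (hγ : |γ| < Real.pi / 2) (hβ : β < 1) : kappa γ β ≠ 0 := by
  intro h
  have := exp_mul_kappa γ β
  rw [h, mul_zero] at this
  have h1 : 0 < 2 * ((1 - β) * Real.cos γ) :=
    mul_pos two_pos (mul_pos (by linarith) (cos_pos_of_abs_lt hγ))
  exact h1.ne (by exact_mod_cast this)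

theorem neg_half_lt_re_div_one_sub {x : ℂ} (hx : ‖x‖ < 1) : -(1 / 2) < (x / (1 - x)).re := by
  have h1 := one_sub_ne_zero_of_norm_lt_one hx
  have h2 : 0 < Complex.normSq (1 - x) := Complex.normSq_pos.2 h1
  have h3 : x.re * x.re + x.im * x.im < 1 := by
    rw [← Complex.normSq_apply, ← Complex.sq_norm]; nlinarith [norm_nonneg x]
  rw [Complex.div_re, ← add_div, lt_div_iff₀ h2, Complex.normSq_apply]
  simp only [Complex.sub_re, Complex.sub_im, Complex.one_re, Complex.one_im]
  nlinarith

theorem differentiableOn_delta {lam : ℂ} (hlam : ‖lam‖ < 1) :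
    DifferentiableOn ℂ (fun z => delta z lam) (closedBall 0 1) := by
  unfold delta
  exact (by fun_prop : DifferentiableOn ℂ (fun z => z + lam) (closedBall 0 1)).div (by fun_prop)
    fun z hz => one_add_conj_mul_ne_zero hlam (by simpa using hz)

theorem extremal_mem_classPAt {γ β : ℝ} (hγ : |γ| < Real.pi / 2) (hβ : β < 1) {a lam : ℂ}
    (hlam : ‖lam‖ < 1) (ha : ‖a‖ ≤ 1) : extremal γ β a lam ∈ classPAt γ β lam := by
  have hcos := cos_pos_of_abs_lt hγ
  have hδ : DifferentiableOn ℂ (fun z => delta (a * z) lam) (ball 0 1) := by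
    refine (differentiableOn_delta hlam).comp (by fun_prop) fun z hz => ?_
    rw [mem_closedBall_zero_iff]
    exact (norm_mul_le_of_norm_le_one ha).trans (mem_ball_zero_iff.1 hz).le
  have hg : DifferentiableOn ℂ
      (fun z => delta (a * z) lam / (1 - delta (a * z) lam * z)) (ball 0 1) :=
    hδ.div (((differentiableOn_const _).sub (hδ.mul differentiableOn_id))) fun z hz =>
      one_sub_ne_zero_of_norm_lt_one (norm_delta_mul_lt_one hlam ha (mem_ball_zero_iff.1 hz))
  have heq : extremal γ β a lam = fun z => 1 + kappa γ β *
      ((fun z => delta (a * z) lam / (1 - delta (a * z) lam * z)) z * z) := by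
    funext z; simp only [extremal]; ring
  have h0 : (0 : ℂ) ∈ ball (0 : ℂ) 1 := by simp
  refine ⟨⟨?_, by simp [extremal], fun z hz => ?_⟩, ?_⟩
  · rw [heq]
    exact (differentiableOn_const _).add ((differentiableOn_const _).mul
      (hg.mul differentiableOn_id))
  · have h1 := neg_half_lt_re_div_one_sub
      (norm_delta_mul_lt_one hlam ha (mem_ball_zero_iff.1 hz))
    rw [extremal, mul_add, ← mul_assoc, exp_mul_kappa, Complex.add_re, Complex.re_ofReal_mul,
      mul_one, mul_comm Complex.I, Complex.exp_ofReal_mul_I_re]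
    have h2 : 0 < (1 - β) * Real.cos γ := mul_pos (by linarith) hcos
    nlinarith
  · have h1 := ((hg.differentiableAt (isOpen_ball.mem_nhds h0)).hasDerivAt.mul
      (hasDerivAt_id (0 : ℂ))).const_mul (kappa γ β) |>.const_add 1
    rw [heq]
    refine h1.deriv.trans ?_
    simp [delta]

/-- A holomorphic self-map of the disk fixing `0` is `z` times a holomorphic map into the closed
disk. -/
theorem exists_eq_mul_of_norm_le_one {f : ℂ → ℂ} (hf : DifferentiableOn ℂ f (ball 0 1))
    (hf0 : f 0 = 0) (hb : ∀ z ∈ ball (0 : ℂ) 1, ‖f z‖ ≤ 1) :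
    ∃ g : ℂ → ℂ, DifferentiableOn ℂ g (ball 0 1) ∧ (∀ z ∈ ball (0 : ℂ) 1, ‖g z‖ ≤ 1) ∧
      (∀ z, f z = g z * z) ∧ g 0 = deriv f 0 := by
  refine ⟨dslope f 0, (Complex.differentiableOn_dslope (ball_mem_nhds _ one_pos)).2 hf,
    fun z hz => ?_, fun z => ?_, dslope_same f 0⟩
  · simpa using Complex.norm_dslope_le_div_of_mapsTo_ball hf
      (R₂ := 1) (fun z hz => by simpa [hf0] using hb z hz) hz
  · have := sub_smul_dslope f 0 z
    rw [hf0, sub_zero, sub_zero, smul_eq_mul] at this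
    rw [← this, mul_comm]

/-- Every member of the class arises from the extremal functions by replacing the unimodular
constant with a holomorphic map `ψ` of the disk into the closed disk. Here `P = 1 + κ ω / (1 - ω)`
with `ω` a self-map of the disk fixing `0`, and `ψ` comes from two applications of the Schwarz
lemma: to `ω`, and to `delta (φ ·) (-lam)` where `ω z = z φ z` and `φ 0 = lam`. -/
theorem exists_eqOn_extremal_of_mem_classPAt {γ β : ℝ} (hγ : |γ| < Real.pi / 2) (hβ : β < 1)
    {lam : ℂ} (hlam : ‖lam‖ < 1) {P : ℂ → ℂ} (hP : P ∈ classPAt γ β lam) :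
    ∃ ψ : ℂ → ℂ, DifferentiableOn ℂ ψ (ball 0 1) ∧ (∀ z ∈ ball (0 : ℂ) 1, ‖ψ z‖ ≤ 1) ∧
      ∀ z ∈ ball (0 : ℂ) 1, P z = extremal γ β (ψ z) lam z := by
  obtain ⟨⟨hPd, hP0, hPre⟩, hP'⟩ := hP
  have hκ := kappa_ne_zero hγ hβ
  have h0 : (0 : ℂ) ∈ ball (0 : ℂ) 1 := by simp
  have hlt : ∀ z ∈ ball (0 : ℂ) 1, ‖P z - 1‖ < ‖P z - 1 + kappa γ β‖ := by
    intro z hz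
    have hE : ‖Complex.exp (Complex.I * γ)‖ = 1 := by
      rw [mul_comm, Complex.norm_exp_ofReal_mul_I]
    rw [← one_mul ‖P z - 1‖, ← one_mul ‖P z - 1 + kappa γ β‖, ← hE, ← norm_mul, ← norm_mul,
      mul_add, exp_mul_kappa]
    refine (sq_lt_sq₀ (norm_nonneg _) (norm_nonneg _)).1 ?_
    have h1 := hPre z hz
    have h2 : 0 < (1 - β) * Real.cos γ := mul_pos (by linarith) (cos_pos_of_abs_lt hγ)
    have h3 : -((1 - β) * Real.cos γ) < (Complex.exp (Complex.I * γ) * (P z - 1)).re := by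
      rw [mul_sub, Complex.sub_re, mul_one, mul_comm Complex.I (γ : ℂ),
        Complex.exp_ofReal_mul_I_re, mul_comm (γ : ℂ)]
      linarith
    set u := Complex.exp (Complex.I * γ) * (P z - 1)
    simp only [Complex.sq_norm, Complex.normSq_apply, Complex.add_re, Complex.add_im,
      Complex.ofReal_re, Complex.ofReal_im]
    nlinarith
  have hne : ∀ z ∈ ball (0 : ℂ) 1, P z - 1 + kappa γ β ≠ 0 := fun z hz =>
    norm_pos_iff.1 ((norm_nonneg _).trans_lt (hlt z hz))
  set ω : ℂ → ℂ := fun z => (P z - 1) / (P z - 1 + kappa γ β) with hω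
  have hωd : DifferentiableOn ℂ ω (ball 0 1) :=
    (hPd.sub_const 1).div ((hPd.sub_const 1).add_const _) hne
  have hω0 : ω 0 = 0 := by simp [hω, hP0]
  have hω' : deriv ω 0 = lam := by
    have h1 := (hPd.differentiableAt (isOpen_ball.mem_nhds h0)).hasDerivAt.sub_const 1
    have h2 := (h1.div (h1.add_const (kappa γ β)) (hne 0 h0)).deriv
    refine h2.trans ?_
    rw [hP0, hP', sub_self, zero_add, zero_mul, sub_zero]
    field_simp
  obtain ⟨φ, hφd, hφ1, hφω, hφ0⟩ := exists_eq_mul_of_norm_le_one hωd hω0 fun z hz => by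
    rw [hω, norm_div, div_le_one (norm_pos_iff.2 (hne z hz))]
    exact (hlt z hz).le
  have hlam' : ‖-lam‖ < 1 := by simpa
  obtain ⟨ψ, hψd, hψ1, hψη, -⟩ := exists_eq_mul_of_norm_le_one (f := fun z => delta (φ z) (-lam))
    ((differentiableOn_delta hlam').comp hφd fun z hz => by simpa using hφ1 z hz)
    (by simp [delta, hφ0, hω'])
    fun z hz => norm_delta_le_one hlam' (hφ1 z hz)
  refine ⟨ψ, hψd, hψ1, fun z hz => ?_⟩
  have h1 : delta (ψ z * z) lam = φ z := by
    rw [← hψη]; exact delta_delta_neg hlam (hφ1 z hz)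
  rw [extremal, h1, ← hφω, hω]
  have := hne z hz
  have h2 : 1 - (P z - 1) / (P z - 1 + kappa γ β) = kappa γ β / (P z - 1 + kappa γ β) := by
    field_simp
    ring
  simp only [h2]
  field_simp
  ring

/-! ### The extremal functions expose points of the region -/

/-- The common denominator of `extremal γ β ψ lam z`, a polynomial affine in `ψ`. -/
def extremalDenom (lam z ψ : ℂ) : ℂ := 1 - lam * z + z * (conj lam - z) * ψ

theorem one_sub_delta_mul_eq {lam z ψ : ℂ} (h : 1 + conj lam * (ψ * z) ≠ 0) :
    1 - delta (ψ * z) lam * z = extremalDenom lam z ψ / (1 + conj lam * (ψ * z)) := by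
  rw [delta, extremalDenom, eq_div_iff h, sub_mul, one_mul, mul_right_comm, div_mul_cancel₀ _ h]
  ring

theorem extremalDenom_ne_zero {lam z ψ : ℂ} (hlam : ‖lam‖ < 1) (hψ : ‖ψ‖ ≤ 1) (hz : ‖z‖ < 1) :
    extremalDenom lam z ψ ≠ 0 := by
  intro h
  have h1 := one_sub_ne_zero_of_norm_lt_one (norm_delta_mul_lt_one hlam hψ hz)
  rw [one_sub_delta_mul_eq (one_add_conj_mul_ne_zero hlam
    ((norm_mul_le_of_norm_le_one hψ).trans hz.le)), h, zero_div] at h1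
  exact h1 rfl

theorem extremal_eq_div {γ β : ℝ} {lam z ψ : ℂ} (hlam : ‖lam‖ < 1) (hψ : ‖ψ‖ ≤ 1) (hz : ‖z‖ < 1) :
    extremal γ β ψ lam z =
      1 + kappa γ β * (z * (ψ * z + lam) / extremalDenom lam z ψ) := by
  have h1 := one_add_conj_mul_ne_zero hlam ((norm_mul_le_of_norm_le_one hψ (z := z)).trans hz.le)
  rw [extremal, one_sub_delta_mul_eq h1, delta]
  have h2 := extremalDenom_ne_zero hlam hψ hz
  congr 2
  rw [div_mul_eq_mul_div, div_div_div_cancel_right₀ h1, mul_comm z]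

/-- The last factor has positive real part when `ψ ≠ a` (`re_extremalDenom_ratio_pos`), so up to
the constant `κ a (1 - |lam|²)` the factor `z ^ 2 / extremalDenom lam z a ^ 2` is normal to the
disk of possible values at `z`. -/
theorem extremal_sub_extremal {γ β : ℝ} {lam z a ψ : ℂ} (hlam : ‖lam‖ < 1) (ha : ‖a‖ = 1)
    (hψ : ‖ψ‖ ≤ 1) (hz : ‖z‖ < 1) :
    extremal γ β a lam z - extremal γ β ψ lam z =
      kappa γ β * a * (1 - lam * conj lam) * (z ^ 2 * (1 / extremalDenom lam z a ^ 2 *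
        ((1 - ψ * conj a) * (extremalDenom lam z a / extremalDenom lam z ψ)))) := by
  have h1 := extremalDenom_ne_zero hlam hψ hz
  have h2 := extremalDenom_ne_zero hlam ha.le hz
  have ha' : a * conj a = 1 := by rw [Complex.mul_conj, ← Complex.sq_norm, ha]; simp
  rw [extremal_eq_div hlam ha.le hz, extremal_eq_div hlam hψ hz]
  have h3 : a * (1 - ψ * conj a) = a - ψ := by linear_combination -ψ * ha'
  have h4 : (a * z + lam) * extremalDenom lam z ψ - (ψ * z + lam) * extremalDenom lam z a
      = z * (1 - lam * conj lam) * (a - ψ) := by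
    unfold extremalDenom; ring
  rw [← h3] at h4
  field_simp
  linear_combination kappa γ β * z * h4

/-- Twice the numerator of the real part is `(1 - |b|²) |1 - w|² + (1 - |w|²) |1 + b|²`. -/
theorem re_mobius_pos {w b : ℂ} (hw : ‖w‖ ≤ 1) (hw1 : w ≠ 1) (hb : ‖b‖ < 1) :
    0 < ((1 - w) * ((1 + b) / (1 + b * w))).re := by
  have hbw : 1 + b * w ≠ 0 := by
    have := one_add_conj_mul_ne_zero (lam := conj b) (by simpa using hb) hw
    simpa using this
  have h1 : (1 - w) * ((1 + b) / (1 + b * w)) =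
      ((1 - w) * (1 + b) * conj (1 + b * w)) * (((Complex.normSq (1 + b * w))⁻¹ : ℝ) : ℂ) := by
    rw [div_eq_mul_inv, Complex.inv_def]
    ring
  rw [h1, Complex.re_mul_ofReal]
  refine mul_pos ?_ (inv_pos.2 (Complex.normSq_pos.2 hbw))
  have h2 : ((1 - w) * (1 + b) * conj (1 + b * w)).re =
      1 / 2 * ((1 - ‖b‖ ^ 2) * ‖1 - w‖ ^ 2) + 1 / 2 * ((1 - ‖w‖ ^ 2) * ‖1 + b‖ ^ 2) := by
    simp only [Complex.sq_norm, Complex.normSq_apply, Complex.add_re, Complex.add_im,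
      Complex.mul_re, Complex.mul_im, Complex.conj_re, Complex.conj_im, Complex.one_re,
      Complex.one_im, Complex.sub_re, Complex.sub_im]
    ring
  rw [h2]
  have h3 : 0 < (1 - ‖b‖ ^ 2) * ‖1 - w‖ ^ 2 :=
    mul_pos (by nlinarith [norm_nonneg b]) (pow_pos (norm_pos_iff.2 (sub_ne_zero.2 hw1.symm)) 2)
  have h4 : 0 ≤ (1 - ‖w‖ ^ 2) * ‖1 + b‖ ^ 2 :=
    mul_nonneg (by nlinarith [norm_nonneg w]) (by positivity)
  linarith

theorem re_extremalDenom_ratio_pos {lam z a ψ : ℂ} (hlam : ‖lam‖ < 1) (ha : ‖a‖ = 1)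
    (hψ : ‖ψ‖ ≤ 1) (hψa : ψ ≠ a) (hz : ‖z‖ < 1) :
    0 < ((1 - ψ * conj a) * (extremalDenom lam z a / extremalDenom lam z ψ)).re := by
  have ha' : a * conj a = 1 := by rw [Complex.mul_conj, ← Complex.sq_norm, ha]; simp
  have hA : 1 - lam * z ≠ 0 := one_sub_ne_zero_of_norm_lt_one
    ((norm_mul_le_of_norm_le_one hlam.le).trans_lt hz)
  -- With `b` as below, `extremalDenom lam z ψ` is proportional to `1 + b * (ψ * conj a)`.
  set b : ℂ := z * (conj lam - z) * a / (1 - lam * z) with hb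
  have hb1 : ‖b‖ < 1 := by
    have h := norm_delta_le_one (z := -z) (lam := conj lam) (by simpa) (by simpa using hz.le)
    have h' : b = a * (delta (-z) (conj lam) * z) := by
      rw [hb, delta, Complex.conj_conj]; ring
    rw [h', norm_mul, ha, one_mul]
    exact (norm_mul_le_of_norm_le_one h).trans_lt hz
  have hba : extremalDenom lam z a = (1 - lam * z) * (1 + b) := by
    rw [hb, extremalDenom]; field_simp
  have hbψ : extremalDenom lam z ψ = (1 - lam * z) * (1 + b * (ψ * conj a)) := by
    rw [hb, extremalDenom]; field_simp
    linear_combination (-z * (conj lam - z) * ψ) * ha'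
  rw [hba, hbψ, mul_div_mul_left _ _ hA]
  refine re_mobius_pos (by rw [norm_mul, RCLike.norm_conj, ha, mul_one]; exact hψ) (fun h => ?_) hb1
  exact hψa (by linear_combination a * h - ψ * ha')

/-- For `D z = extremalDenom lam z a` this is `0 < Re (1 - z D' / D)`, the convexity estimate for
a primitive of `z ^ 2 / D ^ 2`. -/
theorem re_one_add_mul_sq_div_extremalDenom_pos {lam z a : ℂ} (hlam : ‖lam‖ < 1) (ha : ‖a‖ = 1)
    (hz : ‖z‖ < 1) :
    0 < ((1 + a * z ^ 2) / extremalDenom lam z a).re := by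
  have h0 := extremalDenom_ne_zero hlam ha.le hz
  rw [div_eq_mul_inv, Complex.inv_def, ← mul_assoc, Complex.re_mul_ofReal]
  refine mul_pos ?_ (inv_pos.2 (Complex.normSq_pos.2 h0))
  have ha' : a * conj a = 1 := by rw [Complex.mul_conj, ← Complex.sq_norm, ha]; simp
  have hn : z * conj z = ((‖z‖ ^ 2 : ℝ) : ℂ) := by rw [Complex.mul_conj, Complex.sq_norm]
  have h1 : ((1 + a * z ^ 2) * conj (extremalDenom lam z a)).re =
      (1 - ‖z‖ ^ 2) * (1 + ‖z‖ ^ 2 + ((conj lam * a - lam) * z).re) := by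
    have h2 : (1 + a * z ^ 2) * conj (extremalDenom lam z a) =
        ((1 - (‖z‖ ^ 2) ^ 2 : ℝ) : ℂ) + (a * z ^ 2 - conj (a * z ^ 2)) +
          (conj ((conj lam * a - lam) * z) - ((‖z‖ ^ 2 : ℝ) : ℂ) * ((conj lam * a - lam) * z)) := by
      rw [Complex.ofReal_sub, Complex.ofReal_pow, ← hn]
      simp only [extremalDenom, map_add, map_sub, map_mul, map_pow, map_one, Complex.conj_conj,
        Complex.ofReal_one]
      linear_combination (z ^ 2 * conj z * lam - z ^ 2 * conj z ^ 2) * ha'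
    rw [h2]
    simp only [Complex.add_re, Complex.sub_re, Complex.conj_re, Complex.re_ofReal_mul,
      Complex.ofReal_re]
    ring
  rw [h1]
  refine mul_pos (by nlinarith [norm_nonneg z]) ?_
  have h2 : ‖(conj lam * a - lam) * z‖ ≤ 2 * ‖lam‖ * ‖z‖ := by
    rw [norm_mul]
    refine mul_le_mul_of_nonneg_right ((norm_sub_le _ _).trans_eq ?_) (norm_nonneg z)
    rw [norm_mul, RCLike.norm_conj, ha]; ring
  have h3 := neg_le_of_abs_le (Complex.abs_re_le_norm ((conj lam * a - lam) * z))
  nlinarith [norm_nonneg z, norm_nonneg lam, sq_nonneg (‖z‖ - ‖lam‖)]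

/-- The integral of an extremal function is the strict maximum over the region of the real-linear
functional `Re (c * ·)`, and within the class only that function attains it. -/
theorem exists_support_functional {γ β : ℝ} (hγ : |γ| < Real.pi / 2) (hβ : β < 1)
    {lam z₀ a : ℂ} (hlam : ‖lam‖ < 1) (hz₀ : ‖z₀‖ < 1) (hz₀' : z₀ ≠ 0) (ha : ‖a‖ = 1) :
    ∃ c : ℂ, c ≠ 0 ∧ ∀ P ∈ classPAt γ β lam, EqOn P (extremal γ β a lam) (ball 0 1) ∨
      0 < (c * (integralFromZero (extremal γ β a lam) z₀ - integralFromZero P z₀)).re := by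
  have hz₀b : z₀ ∈ ball (0 : ℂ) 1 := by simpa using hz₀
  have hD0 : ∀ z ∈ ball (0 : ℂ) 1, extremalDenom lam z a ≠ 0 := fun z hz =>
    extremalDenom_ne_zero hlam ha.le (by simpa using hz)
  have hD : Differentiable ℂ fun z => extremalDenom lam z a := by
    unfold extremalDenom; fun_prop
  set m : ℂ → ℂ := fun z => 1 / extremalDenom lam z a ^ 2 with hmdef
  have hm : DifferentiableOn ℂ m (ball 0 1) :=
    (differentiableOn_const _).div (hD.differentiableOn.pow 2) fun z hz => pow_ne_zero 2 (hD0 z hz)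
  have hm0 : ∀ z ∈ ball (0 : ℂ) 1, m z ≠ 0 := fun z hz =>
    one_div_ne_zero (pow_ne_zero 2 (hD0 z hz))
  have hstar : ∀ z ∈ ball (0 : ℂ) 1, 0 < (((2 : ℕ) : ℂ) + 1 + z * deriv m z / m z).re := by
    intro z hz
    have h1 : HasDerivAt (fun z => extremalDenom lam z a)
        (-lam + ((conj lam - z) - z) * a) z := by
      have := (((hasDerivAt_id z).const_mul lam).const_sub 1).add
        (((hasDerivAt_id z).mul ((hasDerivAt_id z).const_sub (conj lam))).mul_const a)
      refine this.congr_deriv ?_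
      simp only [id]
      ring
    have h2 := ((hasDerivAt_const z (1 : ℂ)).div (h1.pow 2) (pow_ne_zero 2 (hD0 z hz))).deriv
    have h3 : ((2 : ℕ) : ℂ) + 1 + z * deriv m z / m z =
        1 + (2 : ℝ) * ((1 + a * z ^ 2) / extremalDenom lam z a) := by
      have h4 : deriv m z = _ := h2
      have h5 := hD0 z hz
      rw [h4, hmdef]
      simp only [Pi.pow_apply]
      have h6 : 1 + a * z ^ 2 = extremalDenom lam z a - z * (-lam + ((conj lam - z) - z) * a) := by
        unfold extremalDenom; ring
      rw [h6]
      push_cast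
      field_simp
      ring
    rw [h3, Complex.add_re, Complex.re_ofReal_mul, Complex.one_re]
    linarith [re_one_add_mul_sq_div_extremalDenom_pos hlam ha (mem_ball_zero_iff.1 hz)]
  -- `z₀ ^ 3 * M z₀` is the integral of the normal field `z ^ 2 * m z`.
  obtain ⟨M, hM, hMm⟩ := exists_add_mul_deriv_eq 2 hm
  have hM0 : M z₀ ≠ 0 := fun h => by
    simpa [h] using re_div_pos_of_add_mul_deriv_eq 2 hm hM hm0 hstar hMm hz₀b
  set C : ℂ := kappa γ β * a * (1 - lam * conj lam) with hC
  have hC0 : C ≠ 0 := by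
    refine mul_ne_zero (mul_ne_zero (kappa_ne_zero hγ hβ) (norm_pos_iff.1 (by rw [ha]; simp))) ?_
    rw [mul_comm]
    refine one_sub_ne_zero_of_norm_lt_one ?_
    rw [norm_mul, RCLike.norm_conj]
    nlinarith [norm_nonneg lam]
  refine ⟨(C * (z₀ ^ 3 * M z₀))⁻¹, by
    simp [hC0, hz₀', hM0], fun P hP => ?_⟩
  obtain ⟨ψ, hψd, hψ1, hPψ⟩ := exists_eqOn_extremal_of_mem_classPAt hγ hβ hlam hP
  by_cases hex : ∃ z ∈ ball (0 : ℂ) 1, ψ z = a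
  · left
    -- By the maximum principle, `ψ` is the constant `a`.
    obtain ⟨z₁, hz₁, hψz₁⟩ := hex
    have hconst : EqOn ψ (Function.const ℂ (ψ z₁)) (ball 0 1) :=
      Complex.eqOn_of_isPreconnected_of_isMaxOn_norm (convex_ball _ _).isPreconnected isOpen_ball
        hψd hz₁ fun z hz => by
          simp only [mem_ofPred_eq, Function.comp, hψz₁, ha]
          exact hψ1 z hz
    intro z hz
    rw [hPψ z hz, hconst hz, Function.const_apply, hψz₁]
  · right
    push Not at hex
    set h : ℂ → ℂ := fun z => (1 - ψ z * conj a) *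
      (extremalDenom lam z a / extremalDenom lam z (ψ z)) with hh
    have hhd : DifferentiableOn ℂ h (ball 0 1) := by
      have h1 : DifferentiableOn ℂ (fun z => extremalDenom lam z (ψ z)) (ball 0 1) := by
        unfold extremalDenom; fun_prop
      exact ((differentiableOn_const _).sub (hψd.mul_const _)).mul (hD.differentiableOn.div h1
        fun z hz => extremalDenom_ne_zero hlam (hψ1 z hz) (by simpa using hz))
    have hhpos : ∀ z ∈ ball (0 : ℂ) 1, 0 < (h z).re := fun z hz =>
      re_extremalDenom_ratio_pos hlam ha (hψ1 z hz) (hex z hz) (by simpa using hz)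
    obtain ⟨N, hN, hNm⟩ := exists_add_mul_deriv_eq 2 (hm.mul hhd)
    have hpos := re_div_pos_of_re_pos 2 hm hM hN hm0 hstar hhpos hMm hNm hz₀b
    have hint : integralFromZero (extremal γ β a lam) z₀ - integralFromZero P z₀ =
        C * (z₀ ^ 3 * N z₀) := by
      have h1 := integralFromZero_linear_combination
        (extremal_mem_classPAt hγ hβ hlam ha.le).1.1.continuousOn hP.1.1.continuousOn 1 (-1) hz₀
      have h2 := integralFromZero_linear_combination (f := fun z => z ^ 2 * (m * h) z) (g := 0)
        ((continuousOn_id.pow 2).mul (hm.mul hhd).continuousOn) continuousOn_const C 0 hz₀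
      rw [integralFromZero_pow_mul 2 (hm.mul hhd) hN hNm hz₀, zero_mul, add_zero] at h2
      rw [← h2, sub_eq_add_neg, ← neg_one_mul, ← one_mul (integralFromZero (extremal _ _ _ _) _),
        ← h1]
      refine integralFromZero_congr (fun z hz => ?_) hz₀
      have h3 := extremal_sub_extremal (γ := γ) (β := β) hlam ha (hψ1 z hz) (mem_ball_zero_iff.1 hz)
      simp only [hPψ z hz, Pi.mul_apply, hmdef, hh, hC]
      linear_combination h3
    rw [hint]
    convert hpos using 2
    field_simp

/-! ### The curve and the region -/

theorem convex_region (γ β : ℝ) {z₀ : ℂ} (hz₀ : ‖z₀‖ < 1) (lam : ℂ) :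
    Convex ℝ (region γ β z₀ lam) := by
  rintro _ ⟨P, hP, rfl⟩ _ ⟨Q, hQ, rfl⟩ s t hs ht hst
  have h0 : (0 : ℂ) ∈ ball (0 : ℂ) 1 := by simp
  have hst' : (s : ℂ) + t = 1 := by exact_mod_cast hst
  refine ⟨fun z => (s : ℂ) * P z + t * Q z, ⟨⟨?_, ?_, fun z hz => ?_⟩, ?_⟩, ?_⟩
  · exact (hP.1.1.const_mul _).add (hQ.1.1.const_mul _)
  · simp [hP.1.2.1, hQ.1.2.1, hst']
  · have h1 : Complex.exp (Complex.I * γ) * ((s : ℂ) * P z + t * Q z) =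
        s * (Complex.exp (Complex.I * γ) * P z) + t * (Complex.exp (Complex.I * γ) * Q z) := by ring
    rw [h1, Complex.add_re, Complex.re_ofReal_mul, Complex.re_ofReal_mul]
    have hp := hP.1.2.2 z hz
    have hq := hQ.1.2.2 z hz
    rcases hs.eq_or_lt with rfl | hs'
    · rw [show t = 1 by linarith]; linarith
    · have h2 := mul_lt_mul_of_pos_left hp hs'
      have h3 := mul_le_mul_of_nonneg_left hq.le ht
      have h4 : s * (β * Real.cos γ) + t * (β * Real.cos γ) = β * Real.cos γ := by
        rw [← add_mul, hst, one_mul]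
      linarith
  · have hPd := (hP.1.1.differentiableAt (isOpen_ball.mem_nhds h0)).hasDerivAt
    have hQd := (hQ.1.1.differentiableAt (isOpen_ball.mem_nhds h0)).hasDerivAt
    refine ((hPd.const_mul (s : ℂ)).add (hQd.const_mul (t : ℂ))).deriv.trans ?_
    rw [hP.2, hQ.2, ← add_mul, hst', one_mul]
  · rw [integralFromZero_linear_combination hP.1.1.continuousOn hQ.1.1.continuousOn _ _ hz₀]
    simp [Complex.real_smul]

/-- A point of a set at which a nonzero real-linear functional is maximal lies in the frontier. -/
theorem mem_frontier_of_re_nonneg {V : Set ℂ} {w c : ℂ} (hc : c ≠ 0) (hw : w ∈ V)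
    (h : ∀ v ∈ V, 0 ≤ (c * (w - v)).re) : w ∈ frontier V := by
  refine ⟨subset_closure hw, fun hint => ?_⟩
  have hmin : IsLocalMin (fun s : ℝ => (c * (w - (w + s * conj c))).re) 0 := by
    have hcont : ContinuousAt (fun s : ℝ => w + s * conj c) 0 := by fun_prop
    have hev := hcont.preimage_mem_nhds (by simpa using mem_interior_iff_mem_nhds.1 hint)
    filter_upwards [hev] with s hs
    simpa using h _ hs
  have hd : HasDerivAt (fun s : ℝ => (c * (w - (w + s * conj c))).re) (-Complex.normSq c) 0 := by
    have h1 : (fun s : ℝ => (c * (w - (w + s * conj c))).re) = fun s => s * -Complex.normSq c := by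
      funext s
      rw [show c * (w - (w + s * conj c)) = s * -(c * conj c) by ring, Complex.re_ofReal_mul,
        Complex.mul_conj, Complex.neg_re, Complex.ofReal_re]
    rw [h1]
    simpa using (hasDerivAt_id (0 : ℝ)).mul_const (-Complex.normSq c)
  have := hmin.hasDerivAt_eq_zero hd
  exact hc (Complex.normSq_eq_zero.1 (neg_eq_zero.1 this))

theorem eq_of_eqOn_extremal {γ β : ℝ} (hγ : |γ| < Real.pi / 2) (hβ : β < 1) {lam a b : ℂ}
    (hlam : ‖lam‖ < 1) (ha : ‖a‖ = 1) (hb : ‖b‖ = 1)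
    (h : EqOn (extremal γ β a lam) (extremal γ β b lam) (ball 0 1)) : a = b := by
  by_contra hab
  have hz : ‖(1 / 2 : ℂ)‖ < 1 := by norm_num
  have h1 := extremal_sub_extremal (γ := γ) (β := β) hlam ha hb.le hz
  rw [sub_eq_zero.2 (h (by simpa using hz))] at h1
  have h2 := re_extremalDenom_ratio_pos hlam ha hb.le (Ne.symm hab) hz
  have h3 : (1 - b * conj a) *
      (extremalDenom lam (1 / 2) a / extremalDenom lam (1 / 2) b) ≠ 0 := fun h0 => by
    rw [h0] at h2; simp at h2
  have h4 : 1 - lam * conj lam ≠ 0 := by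
    refine one_sub_ne_zero_of_norm_lt_one ?_
    rw [norm_mul, RCLike.norm_conj]
    nlinarith [norm_nonneg lam]
  have h5 := extremalDenom_ne_zero hlam ha.le hz
  have h6 : a ≠ 0 := norm_pos_iff.1 (by rw [ha]; simp)
  refine absurd h1.symm (mul_ne_zero (mul_ne_zero (mul_ne_zero (kappa_ne_zero hγ hβ) h6) h4)
    (mul_ne_zero (by norm_num) (mul_ne_zero (one_div_ne_zero (pow_ne_zero 2 h5)) h3)))

theorem continuous_integralFromZero_extremal (γ β : ℝ) {lam z₀ : ℂ} (hlam : ‖lam‖ < 1)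
    (hz₀ : ‖z₀‖ < 1) : Continuous fun θ : ℝ =>
      integralFromZero (extremal γ β (Complex.exp (Complex.I * θ)) lam) z₀ := by
  have hnorm : ∀ θ : ℝ, ‖Complex.exp (Complex.I * θ)‖ ≤ 1 := fun θ => by
    rw [mul_comm, Complex.norm_exp_ofReal_mul_I]
  have hmem : ∀ t : ℝ, ‖((max 0 (min t 1) : ℝ) : ℂ) * z₀‖ < 1 := fun t => by
    refine mem_ball_zero_iff.1 (ofReal_mul_mem_ball hz₀ ?_)
    rw [uIcc_of_le zero_le_one]
    exact ⟨le_max_left _ _, max_le zero_le_one (min_le_right _ _)⟩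
  have heq : ∀ θ : ℝ, integralFromZero (extremal γ β (Complex.exp (Complex.I * θ)) lam) z₀ =
      ∫ t in (0 : ℝ)..1, extremal γ β (Complex.exp (Complex.I * θ)) lam
        ((max 0 (min t 1) : ℝ) * z₀) * z₀ := by
    intro θ
    refine intervalIntegral.integral_congr fun t ht => ?_
    rw [uIcc_of_le zero_le_one] at ht
    simp only [min_eq_left ht.2, max_eq_right ht.1]
  -- Truncating `t` to `[0, 1]` makes the integrand continuous for all real `t`.
  simp only [heq]
  refine intervalIntegral.continuous_parametric_intervalIntegral_of_continuous' ?_ 0 1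
  have hδ : Continuous fun p : ℝ × ℝ => delta (Complex.exp (Complex.I * p.1) *
      ((max 0 (min p.2 1) : ℝ) * z₀)) lam := by
    unfold delta
    refine Continuous.div (by fun_prop) (by fun_prop) fun p => ?_
    exact one_add_conj_mul_ne_zero hlam
      ((norm_mul_le_of_norm_le_one (hnorm _)).trans (hmem _).le)
  have hz : Continuous fun p : ℝ × ℝ => ((max 0 (min p.2 1) : ℝ) : ℂ) * z₀ := by fun_prop
  unfold Function.uncurry extremal
  exact (continuous_const.add (continuous_const.mul ((hδ.mul hz).div
    (continuous_const.sub (hδ.mul hz)) fun p => one_sub_ne_zero_of_norm_lt_one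
      (norm_delta_mul_lt_one hlam (hnorm _) (hmem _))))).mul continuous_const

theorem eq_of_exp_I_mul_eq {θ θ' : ℝ} (hθ : θ ∈ Ioc (-Real.pi) Real.pi)
    (hθ' : θ' ∈ Ioc (-Real.pi) Real.pi)
    (h : Complex.exp (Complex.I * θ) = Complex.exp (Complex.I * θ')) : θ = θ' := by
  have h1 : ∀ x ∈ Ioc (-Real.pi) Real.pi, (Complex.exp (Complex.I * (x : ℝ))).arg = x := by
    intro x hx
    rw [mul_comm, Complex.exp_mul_I, Complex.arg_cos_add_sin_mul_I hx]
  rw [← h1 θ hθ, h, h1 θ' hθ']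

/-- A point where a linear functional is larger than at `y` and `z` is not between `y` and `z`. -/
theorem not_wbtw_of_re_pos {c x y z : ℂ} (hy : 0 < (c * (x - y)).re) (hz : 0 < (c * (x - z)).re) :
    ¬ Wbtw ℝ y x z := by
  rintro ⟨t, ht, rfl⟩
  have h1 : (1 - t) * (c * (AffineMap.lineMap y z t - y)).re +
      t * (c * (AffineMap.lineMap y z t - z)).re = 0 := by
    rw [← Complex.re_ofReal_mul, ← Complex.re_ofReal_mul, ← Complex.add_re,
      AffineMap.lineMap_apply, vsub_eq_sub, vadd_eq_add, Complex.real_smul]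
    push_cast
    ring_nf
    simp
  rcases ht.1.eq_or_lt with rfl | h0
  · simp at hy
  · have := mul_nonneg (sub_nonneg.2 ht.2) hy.le
    have := mul_pos h0 hz
    linarith

end VarRegion

theorem theorem5p1 (γ β : ℝ) (hγ : |γ| < Real.pi / 2) (hβ : β < 1)
    (lam z₀ : ℂ) (hlam : ‖lam‖ < 1) (hz₀ : ‖z₀‖ < 1) (hz₀' : z₀ ≠ 0) :
    VarRegion.IsJordanCurveGivenBy (frontier (VarRegion.region γ β z₀ lam))
      (fun θ : ℝ => VarRegion.integralFromZero
        (VarRegion.extremal γ β (Complex.exp (Complex.I * θ)) lam) z₀) ∧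
    (∀ θ ∈ Set.Ioc (-Real.pi) Real.pi,
      VarRegion.integralFromZero
          (VarRegion.extremal γ β (Complex.exp (Complex.I * θ)) lam) z₀ =
        VarRegion.integralFromZero
          (fun ζ => (1 + (2 * (1 - (β : ℂ)) * (Real.cos γ : ℂ) * Complex.exp (-Complex.I * γ) - 1)
              * VarRegion.delta (Complex.exp (Complex.I * θ) * ζ) lam * ζ) /
            (1 - VarRegion.delta (Complex.exp (Complex.I * θ) * ζ) lam * ζ)) z₀) ∧
    (∀ P ∈ VarRegion.classPAt γ β lam, ∀ θ ∈ Set.Ioc (-Real.pi) Real.pi,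
      VarRegion.integralFromZero P z₀ =
          VarRegion.integralFromZero
            (VarRegion.extremal γ β (Complex.exp (Complex.I * θ)) lam) z₀ →
        Set.EqOn P (VarRegion.extremal γ β (Complex.exp (Complex.I * θ)) lam)
          (Metric.ball 0 1)) := by
  have hnorm : ∀ θ : ℝ, ‖Complex.exp (Complex.I * θ)‖ = 1 := fun θ => by
    rw [mul_comm, Complex.norm_exp_ofReal_mul_I]
  have hH : ∀ θ : ℝ, VarRegion.extremal γ β (Complex.exp (Complex.I * θ)) lam ∈
      VarRegion.classPAt γ β lam := fun θ =>
    VarRegion.extremal_mem_classPAt hγ hβ hlam (hnorm θ).le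
  have hsupp := fun θ : ℝ =>
    VarRegion.exists_support_functional hγ hβ hlam hz₀ hz₀' (hnorm θ)
  choose c hc0 hc using hsupp
  have huniq : ∀ P ∈ VarRegion.classPAt γ β lam, ∀ θ : ℝ,
      VarRegion.integralFromZero P z₀ = VarRegion.integralFromZero
        (VarRegion.extremal γ β (Complex.exp (Complex.I * θ)) lam) z₀ →
      Set.EqOn P (VarRegion.extremal γ β (Complex.exp (Complex.I * θ)) lam) (Metric.ball 0 1) := by
    intro P hP θ h
    rcases hc θ P hP with h1 | h1
    · exact h1
    · simp [h] at h1
  set Γ : ℝ → ℂ := fun θ => VarRegion.integralFromZero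
    (VarRegion.extremal γ β (Complex.exp (Complex.I * θ)) lam) z₀ with hΓ
  have hexp : Complex.exp (Complex.I * ((-Real.pi : ℝ) : ℂ)) =
      Complex.exp (Complex.I * (Real.pi : ℂ)) := by
    rw [mul_comm, mul_comm Complex.I, Complex.exp_pi_mul_I]
    push_cast
    rw [neg_mul, Complex.exp_neg, Complex.exp_pi_mul_I]
    norm_num
  have hclosed : Γ (-Real.pi) = Γ Real.pi := by simp only [hΓ, hexp]
  have hcont : Continuous Γ := VarRegion.continuous_integralFromZero_extremal γ β hlam hz₀
  have hinj : Set.InjOn Γ (Set.Ioc (-Real.pi) Real.pi) := fun θ hθ θ' hθ' h =>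
    VarRegion.eq_of_exp_I_mul_eq hθ hθ' (VarRegion.eq_of_eqOn_extremal hγ hβ hlam (hnorm θ)
      (hnorm θ') (huniq _ (hH θ) θ' h))
  have hmem : ∀ θ, Γ θ ∈ VarRegion.region γ β z₀ lam := fun θ => ⟨_, hH θ, rfl⟩
  have hfr : ∀ θ, Γ θ ∈ frontier (VarRegion.region γ β z₀ lam) := by
    refine fun θ => VarRegion.mem_frontier_of_re_nonneg (hc0 θ) (hmem θ) ?_
    rintro _ ⟨P, hP, rfl⟩
    rcases hc θ P hP with h1 | h1
    · rw [VarRegion.integralFromZero_congr h1 hz₀]; simp [hΓ]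
    · exact h1.le
  have hconv := VarRegion.convex_region γ β hz₀ lam
  have hpos : ∀ θ ∈ Set.Ioc (-Real.pi) Real.pi, ∀ θ' ∈ Set.Ioc (-Real.pi) Real.pi, θ ≠ θ' →
      0 < (c θ * (Γ θ - Γ θ')).re := by
    intro θ hθ θ' hθ' hne
    rcases hc θ _ (hH θ') with h1 | h1
    · exact absurd (hinj hθ' hθ (VarRegion.integralFromZero_congr h1 hz₀)) hne.symm
    · exact h1
  -- Three distinct exposed points of a convex set cannot be collinear.
  have hint : (interior (VarRegion.region γ β z₀ lam)).Nonempty := by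
    refine VarRegion.interior_nonempty_of_convex hconv (hmem 0) (hmem 1) (hmem 2) fun hcol => ?_
    have hpi := Real.pi_gt_three
    have m0 : (0 : ℝ) ∈ Set.Ioc (-Real.pi) Real.pi := ⟨by linarith, by linarith⟩
    have m1 : (1 : ℝ) ∈ Set.Ioc (-Real.pi) Real.pi := ⟨by linarith, by linarith⟩
    have m2 : (2 : ℝ) ∈ Set.Ioc (-Real.pi) Real.pi := ⟨by linarith, by linarith⟩
    rcases hcol.wbtw_or_wbtw_or_wbtw with h | h | h
    · exact VarRegion.not_wbtw_of_re_pos (hpos 1 m1 0 m0 (by norm_num))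
        (hpos 1 m1 2 m2 (by norm_num)) h
    · exact VarRegion.not_wbtw_of_re_pos (hpos 2 m2 1 m1 (by norm_num))
        (hpos 2 m2 0 m0 (by norm_num)) h
    · exact VarRegion.not_wbtw_of_re_pos (hpos 0 m0 2 m2 (by norm_num))
        (hpos 0 m0 1 m1 (by norm_num)) h
  refine ⟨⟨hcont.continuousOn, hclosed, hinj, ?_⟩, fun θ _ => ?_, fun P hP θ _ => huniq P hP θ⟩
  · exact VarRegion.image_eq_frontier_of_convex hconv hint (by linarith [Real.pi_pos])
      hcont.continuousOn hclosed hinj fun θ _ => hfr θ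
  · refine VarRegion.integralFromZero_congr (fun z hz => ?_) hz₀
    have h1 := VarRegion.one_sub_ne_zero_of_norm_lt_one
      (VarRegion.norm_delta_mul_lt_one hlam (hnorm θ).le (mem_ball_zero_iff.1 hz))
    simp only [VarRegion.extremal, VarRegion.kappa]
    generalize VarRegion.delta (Complex.exp (Complex.I * θ) * z) lam = d at h1 ⊢
    rw [eq_div_iff h1]
    field_simp
    ring
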